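/- Let $n \ge m \ge 2$. A set $A \subseteq \mathbb{R}^n$ has property $IS^m$ (respectively $ES^m$, $RS^m$) if it contains the vertices of an isosceles (respectively regular, right) $m$-simplex. Here an $m$-simplex is the convex hull of $m+1$ affinely independent points of $\mathbb{R}^n$. It is isosceles if some vertex is at the same distance from all the other vertices, regular if all distances between distinct vertices are equal, and right if for some vertex $p$ the lines joining $p$ to the other vertices are mutually orthogonal. Let $\mathcal{P}$ be one of the properties $IS^m$, $ES^m$, $RS^m$, let $\mathcal{R} \subseteq (0,\infty)$, let $\varepsilon > 0$, and let $\mathcal{C}$ be a set of colors. A coloring $f\colon \mathbb{R}^n \to \mathcal{C}$ satisfies $\mathcal{Q}^*_{\mathcal{P},\mathcal{R}^\varepsilon}$ if * some color class $f^{-1}(c)$ is comeager in some nonempty open subset of $\mathbb{R}^n$; * $\mathcal{R}$ is comeager in $(0,\varepsilon)$; and * for every $c \in \mathcal{C}$, every $p \in \mathbb{R}^n$ and every $r \in \mathcal{R}$: if the set $f^{-1}(c) \cap S_r(p)$, where $S_r(p)$ is the sphere of radius $r$ centered at $p$, has a subset with property $\mathcal{P}$, then $f(p) = c$. 1. If $m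 < n$, or $m = n$ and $\mathcal{P} = IS^n$, or $m = n \ge 3$ and $\mathcal{P} = RS^n$, then every coloring $f\colon \mathbb{R}^n \to \mathcal{C}$ satisfying $\mathcal{Q}^*_{\mathcal{P},\mathcal{R}^\varepsilon}$ is monochromatic (constant on $\mathbb{R}^n$). 2. If $m = n$ and $\mathcal{P} = ES^n$, or $m = n = 2$ and $\mathcal{P} = RS^2$, then every coloring $f\colon \mathbb{R}^n \to \mathcal{C}$ satisfying $\mathcal{Q}^*_{\mathcal{P},\mathcal{R}^\varepsilon}$ is constant on some nonempty open subset of $\mathbb{R}^n$. It need not be monochromatic: whenever $\mathcal{R}$ is comeager in $(0,\varepsilon)$, the horizontal-strip coloring $f\colon\mathbb{R}^n\to\mathbb{Z}$, $f(x_1,\dots,x_n) = \lfloor x_n \rfloor$, satisfies $\mathcal{Q}^*_{\mathcal{P},\mathcal{R}^\varepsilon}$ and is not monochromatic; moreover, for every set $\mathcal{C}$ with at least two elements there is a coloring $f\colon\mathbb{R}^n\to\mathcal{C}$ that satisfies $\mathcal{Q}^*_{\mathcal{P},\mathcal{R}^\varepsilon}$ and is not monochromatic. -/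

import Mathlib

namespace SphereColoring

/-- `ℝⁿ` with the Euclidean distance. -/
abbrev E (n : ℕ) : Type := EuclideanSpace ℝ (Fin n)

/-! ### Baire category -/

/-- `A` is comeager in `U`: the set `A ∩ U` is comeager in the subspace `U`. -/
def ComeagerIn {X : Type*} [TopologicalSpace X] (A U : Set X) : Prop :=
  ((↑) ⁻¹' A : Set U) ∈ residual U

/-- `A` is comeager in some nonempty open set. -/
def SomewhereComeager {X : Type*} [TopologicalSpace X] (A : Set X) : Prop :=
  ∃ U : Set X, IsOpen U ∧ U.Nonempty ∧ ComeagerIn A U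

/-! ### Colorings -/

/-- The coloring `f` is constant. -/
def Monochromatic {X C : Type*} (f : X → C) : Prop :=
  ∀ x y, f x = f y

/-- The coloring `f` is constant on some nonempty open set. -/
def SomewhereMonochromatic {X C : Type*} [TopologicalSpace X] (f : X → C) : Prop :=
  ∃ U : Set X, IsOpen U ∧ U.Nonempty ∧ ∀ x ∈ U, ∀ y ∈ U, f x = f y

/-- Some color class of `f` is somewhere comeager. -/
def SomewhereComeagerColoring {X C : Type*} [TopologicalSpace X] (f : X → C) : Prop :=
  ∃ c : C, SomewhereComeager (f ⁻¹' {c})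

/-- The forcing condition: for every color `c`, center `p ∈ M` and radius `r ∈ R`, if the part of
the sphere of center `p` and radius `r` that has color `c` has a subset with property `P`,
then `p` has color `c`. -/
def SatisfiesQ {n : ℕ} {C : Type*} (P : Set (E n) → Prop) (M : Set (E n)) (R : Set ℝ)
    (f : E n → C) : Prop :=
  ∀ c : C, ∀ p ∈ M, ∀ r ∈ R,
    (∃ T : Set (E n), T ⊆ f ⁻¹' {c} ∩ Metric.sphere p r ∧ P T) → f p = c

/-- `R` is a set of positive radii that is comeager in `(0, ε)`, where `ε > 0`. -/
structure RadiiComeagerNearZero (R : Set ℝ) (ε : ℝ) : Prop where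
  eps_pos : 0 < ε
  radii_pos : R ⊆ Set.Ioi 0
  comeager : ComeagerIn R (Set.Ioo 0 ε)

/-- The condition `Q*` on a coloring `f` of `ℝⁿ`: all points are admissible centers, the set `R` of
admissible radii is comeager in `(0, ε)`, and `f` is a somewhere comeager coloring that
satisfies the forcing condition. -/
structure SatisfiesQStar {n : ℕ} {C : Type*} (P : Set (E n) → Prop) (R : Set ℝ) (ε : ℝ)
    (f : E n → C) : Prop where
  radii : RadiiComeagerNearZero R ε
  coloring : SomewhereComeagerColoring f
  forcing : SatisfiesQ P Set.univ R f

/-! ### Simplices -/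

/-- Some vertex (an apex) is at the same distance from all the other vertices. -/
def IsIsosceles {n m : ℕ} (s : Affine.Simplex ℝ (E n) m) : Prop :=
  ∃ i, ∃ d : ℝ, ∀ j, j ≠ i → dist (s.points i) (s.points j) = d

/-- The lines joining some vertex (an apex) with the other vertices are mutually orthogonal. -/
def IsRight {n m : ℕ} (s : Affine.Simplex ℝ (E n) m) : Prop :=
  ∃ i, ∀ j k, j ≠ i → k ≠ i → j ≠ k →
    inner ℝ (s.points j - s.points i) (s.points k - s.points i) = 0

/-- `A` contains the vertices of an isosceles `m`-simplex. -/
def IS (n m : ℕ) (A : Set (E n)) : Prop :=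
  ∃ s : Affine.Simplex ℝ (E n) m, IsIsosceles s ∧ Set.range s.points ⊆ A

/-- `A` contains the vertices of a regular `m`-simplex: one whose distances between distinct
vertices are all equal. -/
def ES (n m : ℕ) (A : Set (E n)) : Prop :=
  ∃ s : Affine.Simplex ℝ (E n) m, s.Equilateral ∧ Set.range s.points ⊆ A

/-- `A` contains the vertices of a right `m`-simplex. -/
def RS (n m : ℕ) (A : Set (E n)) : Prop :=
  ∃ s : Affine.Simplex ℝ (E n) m, IsRight s ∧ Set.range s.points ⊆ A

/-- The coloring of `ℝⁿ` by horizontal strips, `(x₁, …, xₙ) ↦ ⌊xₙ⌋`. -/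
noncomputable def strips (n : ℕ) (hn : 0 < n) (x : E n) : ℤ :=
  ⌊x ⟨n - 1, Nat.sub_lt hn Nat.one_pos⟩⌋

end SphereColoring

open SphereColoring

/-!
Let `c` be a colour whose class is comeager in the open set `U`, and let `v` be a family of points
on a sphere about the origin whose range has the property `P`. For a centre `p ∈ U` and a vector
`u`, the half-turn about the line `ℝ u`, scaled by `‖u‖²` and followed by the translation by `p`,
carries `v` to a similar copy inscribed in the sphere of centre `p` and radius `‖u‖² ρ`.
For each `i`, the map `u ↦ p + (2 ⟪v i, u⟫ u - ‖u‖² v i)` has an invertible derivative wherever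
`⟪v i, u⟫ ≠ 0`, so it is open there, and preimages of comeager sets are comeager. By the Baire
category theorem some small `u` sends all the `v i` into the class of `c` and has an admissible
radius. Hence `f p = c`, and `f` is constant on `U` (`eq_of_comeagerIn`).

Suppose moreover that `v` lies in an open hemisphere, and that the interior `W` of the class of `c`
is not the whole space. Take a maximal ball in `W` about some point of `W`, and a point `q ∉ W` on
its boundary. A small copy of `v` around `q`, turned towards the centre of the ball, lies in `W`,
and so does the same copy around any point near `q`. So all points near `q` have colour `c`, which
contradicts `q ∉ W` (`monochromatic_of_hemisphere`). Such a family exists when `m < n` (shift the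
centre along a direction orthogonal to the simplex), for `IS` when `m = n` (put the apex at the
pole), and for `RS` when `m = n ≥ 3` (the circumcentre of `0, e₁, …, eₙ` is beyond the face opposite
to `0`).

In the remaining cases the centre of the sphere is in the convex hull of every inscribed simplex: it
is the centroid of a regular `n`-simplex and the midpoint of the hypotenuse of a right triangle. So
every colouring with convex classes satisfies the forcing condition (`satisfiesQ_of_convex`), in
particular the strips and the colouring by two complementary half-spaces.
-/

/-! ### Comeager sets and open maps -/

open Topology Filter in
/-- A map that is continuous and open at every point of an open set `W` pulls comeager sets back to
comeager sets. -/
theorem SphereColoring.ComeagerIn.preimage {X Y : Type*} [TopologicalSpace X] [TopologicalSpace Y]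
    {A U : Set Y} {W : Set X} {Φ : X → Y} (hA : ComeagerIn A U) (hW : IsOpen W)
    (hmap : ∀ u ∈ W, map Φ (𝓝 u) = 𝓝 (Φ u)) (hWU : Set.MapsTo Φ W U) :
    ComeagerIn (Φ ⁻¹' A) W := by
  have hcont : Continuous (W.domRestrict Φ) :=
    continuousOn_iff_continuous_domRestrict.1 fun u hu =>
      ContinuousAt.continuousWithinAt (hmap u hu).le
  have hopen : IsOpenMap (W.domRestrict Φ) := by
    refine IsOpenMap.of_nhds_le fun u => ?_
    rw [Set.domRestrict_apply, ← hmap u u.2, ← hW.nhdsWithin_eq u.2, nhdsWithin_eq_map_subtype_coe u.2,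
      Filter.map_map]
    rfl
  exact tendsto_residual_of_isOpenMap (hcont.codRestrict fun u => hWU u.2)
    (hopen.codRestrict fun u => hWU u.2) hA

theorem exists_mem_of_comeagerIn {X ι : Type*} [TopologicalSpace X] [Finite ι] {W B : Set X}
    [BaireSpace W] (hne : W.Nonempty) {A : ι → Set X} (hA : ∀ i, ComeagerIn (A i) W)
    (hB : ComeagerIn B W) : ∃ u ∈ W, u ∈ B ∧ ∀ i, u ∈ A i := by
  have : Nonempty W := hne.to_subtype
  have h : ((↑) ⁻¹' B ∩ ⋂ i, (↑) ⁻¹' A i : Set W) ∈ residual W :=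
    Filter.inter_mem hB (Filter.iInter_mem.2 hA)
  obtain ⟨u, hu, hu'⟩ := (dense_of_mem_residual h).nonempty
  exact ⟨u, u.2, hu, fun i => Set.mem_iInter.1 hu' i⟩

/-! ### Invariance under similarities -/

/-- The property `P` passes to supersets and to images under similarities, written as a linear
isometry followed by a homothety of ratio `k ≠ 0` and a translation. -/
structure SimilarityInvariant {n : ℕ} (P : Set (E n) → Prop) : Prop where
  mono : ∀ {A B : Set (E n)}, A ⊆ B → P A → P B
  image : ∀ {A : Set (E n)} (p : E n) {k : ℝ} (g : E n ≃ₗᵢ[ℝ] E n), k ≠ 0 → P A →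
    P ((fun x => p + k • g x) '' A)

theorem exists_simplex_image {n m : ℕ} (s : Affine.Simplex ℝ (E n) m) (p : E n) {k : ℝ}
    (g : E n ≃ₗᵢ[ℝ] E n) (hk : k ≠ 0) :
    ∃ t : Affine.Simplex ℝ (E n) m, ∀ i, t.points i = p + k • g (s.points i) := by
  let φ : E n →ᵃ[ℝ] E n :=
    (k • g.toLinearEquiv.toLinearMap).toAffineMap + AffineMap.const ℝ (E n) p
  have hφ : ∀ x, φ x = p + k • g x := fun x => by simp [φ, add_comm]
  have hinj : Function.Injective φ := fun x y h => by
    rw [hφ, hφ] at h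
    exact g.injective (smul_right_injective _ hk (add_left_cancel h))
  exact ⟨s.map φ hinj, fun i => hφ _⟩

theorem dist_similarity {n : ℕ} (p : E n) (k : ℝ) (g : E n ≃ₗᵢ[ℝ] E n) (x y : E n) :
    dist (p + k • g x) (p + k • g y) = |k| * dist x y := by
  rw [dist_add_left, dist_smul₀, g.dist_map, Real.norm_eq_abs]

theorem similarityInvariant_IS (n m : ℕ) : SimilarityInvariant (IS n m) where
  mono hAB := fun ⟨s, hs, hA⟩ => ⟨s, hs, hA.trans hAB⟩
  image := by
    rintro A p k g hk ⟨s, ⟨i, d, hi⟩, hA⟩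
    obtain ⟨t, ht⟩ := exists_simplex_image s p g hk
    refine ⟨t, ⟨i, |k| * d, fun j hj => ?_⟩, ?_⟩
    · rw [ht, ht, dist_similarity, hi j hj]
    · rintro _ ⟨j, rfl⟩
      exact ⟨s.points j, hA ⟨j, rfl⟩, (ht j).symm⟩

theorem similarityInvariant_ES (n m : ℕ) : SimilarityInvariant (ES n m) where
  mono hAB := fun ⟨s, hs, hA⟩ => ⟨s, hs, hA.trans hAB⟩
  image := by
    rintro A p k g hk ⟨s, ⟨d, hd⟩, hA⟩
    obtain ⟨t, ht⟩ := exists_simplex_image s p g hk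
    refine ⟨t, ⟨|k| * d, fun i j hj => ?_⟩, ?_⟩
    · rw [ht, ht, dist_similarity, hd i j hj]
    · rintro _ ⟨j, rfl⟩
      exact ⟨s.points j, hA ⟨j, rfl⟩, (ht j).symm⟩

theorem similarityInvariant_RS (n m : ℕ) : SimilarityInvariant (RS n m) where
  mono hAB := fun ⟨s, hs, hA⟩ => ⟨s, hs, hA.trans hAB⟩
  image := by
    rintro A p k g hk ⟨s, ⟨i, hi⟩, hA⟩
    obtain ⟨t, ht⟩ := exists_simplex_image s p g hk
    refine ⟨t, ⟨i, fun j l hj hl hjl => ?_⟩, ?_⟩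
    · rw [ht, ht, ht, add_sub_add_left_eq_sub, add_sub_add_left_eq_sub, ← smul_sub, ← smul_sub,
        ← map_sub, ← map_sub, real_inner_smul_left, real_inner_smul_right, g.inner_map_map,
        hi j l hj hl hjl, mul_zero, mul_zero]
    · rintro _ ⟨j, rfl⟩
      exact ⟨s.points j, hA ⟨j, rfl⟩, (ht j).symm⟩

/-! ### Filling an open set by the Baire category theorem -/

open Topology Filter in
/-- The image of `v` under the half-turn about the line `ℝ u`, scaled by `‖u‖²`, depends on `u` in
an open way wherever `u` is not orthogonal to `v`: the derivative there is injective. -/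
theorem map_nhds_half_turn {n : ℕ} (p : E n) {v u : E n} (hv : v ≠ 0) (hu : inner ℝ v u ≠ 0) :
    map (fun u : E n => p + ((2 * inner ℝ v u) • u - ‖u‖ ^ 2 • v)) (𝓝 u) =
      𝓝 (p + ((2 * inner ℝ v u) • u - ‖u‖ ^ 2 • v)) := by
  let Φ := fun u : E n => p + ((2 * inner ℝ v u) • u - ‖u‖ ^ 2 • v)
  have hs : ContDiff ℝ 1 Φ :=
    contDiff_const.add (((contDiff_const.mul (contDiff_const.inner ℝ contDiff_id)).smul
      contDiff_id).sub ((contDiff_norm_sq ℝ).smul contDiff_const))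
  have hd : HasStrictFDerivAt Φ (fderiv ℝ Φ u) u :=
    hs.contDiffAt.hasStrictFDerivAt one_ne_zero
  have hval : ∀ h, fderiv ℝ Φ u h =
      (2 * inner ℝ v u) • h + (2 * inner ℝ v h) • u - (2 * inner ℝ u h) • v := fun h => by
    have h1 : HasFDerivAt (fun u : E n => 2 * inner ℝ v u) ((2 : ℝ) • innerSL ℝ v) u :=
      ((innerSL ℝ v).hasFDerivAt).const_mul 2
    have h2 : HasFDerivAt (fun u : E n => ‖u‖ ^ 2) (2 • innerSL ℝ u) u :=
      (hasStrictFDerivAt_norm_sq u).hasFDerivAt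
    have h3 := ((h1.smul (hasFDerivAt_id u)).sub (h2.smul_const v)).const_add p
    rw [HasFDerivAt.fderiv (f := Φ) h3]
    simp [two_smul, two_mul]
  have hinj : Function.Injective (fderiv ℝ Φ u) := by
    refine (injective_iff_map_eq_zero _).2 fun h h0 => ?_
    rw [hval] at h0
    -- pairing with `u` and `v` gives `⟪v, h⟫ = 0` and `⟪u, h⟫ = 0`, after which `⟪v, u⟫ • h = 0`
    have e1 := congrArg (fun x => inner ℝ v x) h0
    have e2 := congrArg (fun x => inner ℝ u x) h0
    simp only [inner_sub_right, inner_add_right, real_inner_smul_right, inner_zero_right] at e1 e2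
    have hvv : 0 < (inner ℝ v v : ℝ) := real_inner_self_pos.2 hv
    have hu0 : u ≠ 0 := by rintro rfl; simp at hu
    have huu : 0 < (inner ℝ u u : ℝ) := real_inner_self_pos.2 hu0
    rw [real_inner_comm v u] at e2
    have e3 : (inner ℝ v h : ℝ) = 0 := by
      have : (inner ℝ v h : ℝ) * inner ℝ u u = 0 := by linear_combination e2 / 2
      exact (mul_eq_zero.1 this).resolve_right huu.ne'
    have e4 : (inner ℝ u h : ℝ) = 0 := by
      have : (inner ℝ u h : ℝ) * inner ℝ v v = 0 := by
        rw [e3] at e1; linear_combination -e1 / 2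
      exact (mul_eq_zero.1 this).resolve_right hvv.ne'
    rw [e3, e4] at h0
    simpa [hu] using h0
  have hsurj : Function.Surjective (fderiv ℝ Φ u) :=
    LinearMap.injective_iff_surjective (f := (fderiv ℝ Φ u).toLinearMap).1 hinj
  exact hd.map_nhds_eq_of_surj (LinearMap.range_eq_top.2 hsurj)

open Topology Filter in
theorem map_nhds_norm_sq_mul {n : ℕ} {ρ : ℝ} (hρ : ρ ≠ 0) {u : E n} (hu : u ≠ 0) :
    map (fun u : E n => ‖u‖ ^ 2 * ρ) (𝓝 u) = 𝓝 (‖u‖ ^ 2 * ρ) := by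
  have h2 : HasStrictFDerivAt (fun u : E n => ‖u‖ ^ 2 * ρ) (ρ • (2 • innerSL ℝ u)) u :=
    (hasStrictFDerivAt_norm_sq u).mul_const ρ
  refine h2.map_nhds_eq_of_surj (LinearMap.range_eq_top.2 fun t => ?_)
  have huu : (inner ℝ u u : ℝ) ≠ 0 := (real_inner_self_pos.2 hu).ne'
  refine ⟨(t / (2 * ρ * inner ℝ u u)) • u, ?_⟩
  simp
  field_simp

theorem half_turn_eq {n : ℕ} {u : E n} (hu : u ≠ 0) (v : E n) :
    (2 * inner ℝ v u) • u - ‖u‖ ^ 2 • v = ‖u‖ ^ 2 • (Submodule.span ℝ {u}).reflection v := by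
  have : ‖u‖ ≠ 0 := norm_ne_zero_iff.2 hu
  rw [Submodule.reflection_singleton_apply, smul_sub, real_inner_comm]
  congr 1
  rw [← Nat.cast_smul_eq_nsmul ℝ, smul_smul, smul_smul]
  congr 1
  simp
  field_simp

theorem exists_inner_ne_zero {n : ℕ} {ι : Type*} [Finite ι] (v : ι → E n) (hv : ∀ i, v i ≠ 0) :
    ∃ u : E n, ∀ i, (inner ℝ (v i) u : ℝ) ≠ 0 := by
  obtain ⟨φ, hφ⟩ := Module.exists_dual_forall_apply_ne_zero (K := ℝ) v hv
  refine ⟨(InnerProductSpace.toDual ℝ (E n)).symm (LinearMap.toContinuousLinearMap φ), fun i => ?_⟩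
  rw [real_inner_comm, InnerProductSpace.toDual_symm_apply]
  exact hφ i

/-- If `P` has an inscribed realization and the class of `c` is comeager in the open set `U`, then
every point of `U` has colour `c`. -/
theorem eq_of_comeagerIn {n : ℕ} {ι C : Type*} [Finite ι] [Nonempty ι] {P : Set (E n) → Prop}
    (hP : SimilarityInvariant P) {v : ι → E n} {ρ : ℝ} (hρ : 0 < ρ) (hv : ∀ i, ‖v i‖ = ρ)
    (hPv : P (Set.range v)) {R : Set ℝ} {ε : ℝ} (hR : RadiiComeagerNearZero R ε) {f : E n → C}
    (hf : SatisfiesQ P Set.univ R f) {c : C} {U : Set (E n)} (hU : IsOpen U)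
    (hc : ComeagerIn (f ⁻¹' {c}) U) {p : E n} (hp : p ∈ U) : f p = c := by
  obtain ⟨η, hη, hball⟩ := Metric.isOpen_iff.1 hU p hp
  have hv0 : ∀ i, v i ≠ 0 := fun i h => by
    have := hv i; rw [h, norm_zero] at this; exact hρ.ne this
  set δ := min ε η with hδ
  have hδ0 : 0 < δ := lt_min hR.eps_pos hη
  -- the parameters: small vectors, none of them orthogonal to a `v i`
  let W : Set (E n) := {u | ‖u‖ ^ 2 * ρ < δ} ∩ ⋂ i, {u | (inner ℝ (v i) u : ℝ) ≠ 0}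
  have hW : IsOpen W := by
    refine (isOpen_lt (by fun_prop) continuous_const).inter (isOpen_iInter_of_finite fun i => ?_)
    exact isOpen_ne_fun (by fun_prop) continuous_const
  have hW0 : ∀ u ∈ W, u ≠ 0 := by
    rintro u hu rfl
    exact Set.mem_iInter.1 hu.2 (Classical.arbitrary ι) (inner_zero_right _)
  have hWne : W.Nonempty := by
    obtain ⟨u, hu⟩ := exists_inner_ne_zero v hv0
    have ht : Filter.Tendsto (fun t : ℝ => ‖t • u‖ ^ 2 * ρ) (nhdsWithin 0 {0}ᶜ) (nhds 0) := by
      have : Continuous fun t : ℝ => ‖t • u‖ ^ 2 * ρ := by fun_prop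
      have := this.tendsto 0
      simp only [zero_smul, norm_zero, ne_eq, OfNat.ofNat_ne_zero, not_false_eq_true, zero_pow,
        zero_mul] at this
      exact this.mono_left nhdsWithin_le_nhds
    obtain ⟨t, ht1, ht2⟩ := ((ht.eventually_lt_const hδ0).and self_mem_nhdsWithin).exists
    refine ⟨t • u, ht1, Set.mem_iInter.2 fun i => ?_⟩
    simp only [Set.mem_ofPred_eq, real_inner_smul_right]
    exact mul_ne_zero ht2 (hu i)
  let Φ : ι → E n → E n := fun i u => p + ((2 * inner ℝ (v i) u) • u - ‖u‖ ^ 2 • v i)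
  have hΦ : ∀ i, ∀ u ∈ W, dist (Φ i u) p = ‖u‖ ^ 2 * ρ := fun i u hu => by
    simp only [Φ]
    rw [half_turn_eq (hW0 u hu), dist_self_add_left, norm_smul, LinearIsometryEquiv.norm_map, hv,
      norm_pow, norm_norm]
  have hA : ∀ i, ComeagerIn (Φ i ⁻¹' (f ⁻¹' {c})) W := fun i => by
    refine hc.preimage hW (fun u hu => map_nhds_half_turn p (hv0 i) (Set.mem_iInter.1 hu.2 i))
      fun u hu => hball ?_
    rw [Metric.mem_ball, hΦ i u hu]
    exact lt_of_lt_of_le hu.1 (min_le_right _ _)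
  have hB : ComeagerIn ((fun u : E n => ‖u‖ ^ 2 * ρ) ⁻¹' R) W := by
    refine hR.comeager.preimage hW (fun u hu => map_nhds_norm_sq_mul hρ.ne' (hW0 u hu))
      fun u hu => ⟨?_, lt_of_lt_of_le hu.1 (min_le_left _ _)⟩
    have := norm_pos_iff.2 (hW0 u hu)
    positivity
  have : LocallyCompactSpace W := hW.locallyCompactSpace
  obtain ⟨u, huW, huR, huA⟩ := exists_mem_of_comeagerIn hWne hA hB
  refine hf c p trivial _ huR ⟨Set.range fun i => Φ i u, ?_, ?_⟩
  · rintro _ ⟨i, rfl⟩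
    exact ⟨huA i, hΦ i u huW⟩
  · have hk : ‖u‖ ^ 2 ≠ 0 := pow_ne_zero 2 (norm_ne_zero_iff.2 (hW0 u huW))
    refine hP.mono ?_ (hP.image p (Submodule.span ℝ {u}).reflection hk hPv)
    rintro _ ⟨_, ⟨i, rfl⟩, rfl⟩
    exact ⟨i, by simp only [Φ, half_turn_eq (hW0 u huW)]⟩

/-! ### Spreading from an open set to the whole space -/

theorem SphereColoring.RadiiComeagerNearZero.exists_lt {R : Set ℝ} {ε : ℝ}
    (hR : RadiiComeagerNearZero R ε) {δ : ℝ} (hδ : 0 < δ) : ∃ r ∈ R, 0 < r ∧ r < δ := by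
  have hd : Dense ((↑) ⁻¹' R : Set (Set.Ioo 0 ε)) := by
    have : LocallyCompactSpace (Set.Ioo 0 ε) := isOpen_Ioo.locallyCompactSpace
    exact dense_of_mem_residual hR.comeager
  have hpos : 0 < min ε δ := lt_min hR.eps_pos hδ
  have hopen : IsOpen {x : Set.Ioo 0 ε | (x : ℝ) < δ} :=
    isOpen_lt continuous_subtype_val continuous_const
  obtain ⟨x, hx, hxR⟩ := hd.inter_open_nonempty _ hopen
    ⟨⟨min ε δ / 2, by positivity, by linarith [min_le_left ε δ]⟩, by
      simp only [Set.mem_ofPred_eq]; linarith [min_le_right ε δ]⟩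
  exact ⟨x, hxR, x.2.1, hx⟩

open Topology Filter in
/-- If `P` has an inscribed realization in an open hemisphere, then a colour that fills some
nonempty open set fills the whole space. -/
theorem monochromatic_of_hemisphere {n : ℕ} {ι C : Type*} [Finite ι] {P : Set (E n) → Prop}
    (hP : SimilarityInvariant P) {v : ι → E n} {ρ : ℝ} (hρ : 0 < ρ) (hv : ∀ i, ‖v i‖ = ρ)
    (hPv : P (Set.range v)) {e : E n} (he : ‖e‖ = 1) (hev : ∀ i, 0 < (inner ℝ e (v i) : ℝ))
    {R : Set ℝ} {ε : ℝ} (hR : RadiiComeagerNearZero R ε) {f : E n → C}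
    (hf : SatisfiesQ P Set.univ R f) {c : C} {U : Set (E n)} (hU : IsOpen U) (hne : U.Nonempty)
    (hc : ∀ x ∈ U, f x = c) (x : E n) : f x = c := by
  set W := interior (f ⁻¹' {c}) with hWdef
  suffices h : W = Set.univ by
    have hx : x ∈ W := h ▸ Set.mem_univ x
    exact (interior_subset hx : x ∈ f ⁻¹' {c})
  by_contra hW
  obtain ⟨a, ha⟩ : W.Nonempty := hne.mono (interior_maximal hc hU)
  have hcl : IsClosed Wᶜ := isOpen_interior.isClosed_compl
  -- `ball a D` is the maximal ball about `a` in `W`, and `q ∉ W` is on its boundary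
  obtain ⟨q, hq, hqd⟩ := hcl.exists_infDist_eq_dist (Set.nonempty_compl.2 hW) a
  set D := dist a q with hD
  have hball : Metric.ball a D ⊆ W := hqd ▸ Metric.ball_infDist_compl_subset
  have haq : a ≠ q := fun h => hq (h ▸ ha)
  have hD0 : 0 < D := dist_pos.2 haq
  obtain ⟨g, hg⟩ : ∃ g : E n ≃ₗᵢ[ℝ] E n, g e = D⁻¹ • (a - q) := by
    refine ⟨(Submodule.span ℝ {e - D⁻¹ • (a - q)})ᗮ.reflection, Submodule.reflection_sub ?_⟩
    rw [he, norm_smul, norm_inv, Real.norm_of_nonneg hD0.le, ← dist_eq_norm, ← hD,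
      inv_mul_cancel₀ hD0.ne']
  have haq' : a = q + D • g e := by
    rw [hg, smul_inv_smul₀ hD0.ne']; abel
  obtain ⟨t, ht0, ht⟩ : ∃ t : ℝ, 0 < t ∧ ∀ i, t < inner ℝ e (v i) := by
    have hlt : ∀ᶠ t in 𝓝[>] (0 : ℝ), ∀ i, t < inner ℝ e (v i) :=
      eventually_all.2 fun i => nhdsWithin_le_nhds (gt_mem_nhds (hev i))
    obtain ⟨t, h1, h2⟩ := (hlt.and self_mem_nhdsWithin).exists
    exact ⟨t, h2, h1⟩
  -- `‖D e - (r / ρ) v i‖² = D² - 2 (r / ρ) D ⟪e, v i⟫ + r²` is less than `D²` for these `r`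
  obtain ⟨r, hrR, hr0, hr⟩ := hR.exists_lt (δ := 2 * D * t / ρ) (by positivity)
  have hk : 0 < r / ρ := by positivity
  have hqW : ∀ i, q + (r / ρ) • g (v i) ∈ W := fun i => hball <| by
    rw [Metric.mem_ball, haq', dist_add_left, dist_eq_norm, ← map_smul, ← map_smul, ← map_sub,
      LinearIsometryEquiv.norm_map]
    refine lt_of_pow_lt_pow_left₀ 2 hD0.le ?_
    rw [norm_sub_sq_real, norm_smul, norm_smul, real_inner_smul_left, real_inner_smul_right, hv, he,
      Real.norm_of_nonneg hk.le, Real.norm_of_nonneg hD0.le, div_mul_cancel₀ _ hρ.ne',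
      real_inner_comm]
    have h1 : r < 2 * D * t / ρ := hr
    have h2 : r / ρ * (D * t) < r / ρ * (D * inner ℝ e (v i)) := by
      have := ht i
      gcongr
    have h3 : r ^ 2 < r * (2 * D * t / ρ) := by rw [sq]; gcongr
    have h4 : r * (2 * D * t / ρ) = 2 * (r / ρ * (D * t)) := by field_simp
    linarith
  have hev : ∀ᶠ p in 𝓝 q, ∀ i, p + (r / ρ) • g (v i) ∈ W := by
    refine eventually_all.2 fun i => ?_
    have : Continuous fun p : E n => p + (r / ρ) • g (v i) := by fun_prop
    exact this.continuousAt.eventually_mem (isOpen_interior.mem_nhds (hqW i))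
  refine hq (mem_interior_iff_mem_nhds.2 ?_)
  filter_upwards [hev] with p hp
  refine hf c p trivial r hrR ⟨(fun x => p + (r / ρ) • g x) '' Set.range v, ?_,
    hP.image p g hk.ne' hPv⟩
  rintro _ ⟨_, ⟨i, rfl⟩, rfl⟩
  refine ⟨interior_subset (hp i), ?_⟩
  simp only [Metric.mem_sphere, dist_self_add_left, norm_smul, LinearIsometryEquiv.norm_map, hv]
  rw [Real.norm_of_nonneg hk.le, div_mul_cancel₀ _ hρ.ne']

/-! ### Inscribed simplices -/

/-- The point `a • ∑ j, u j` (index `0`) followed by the points of the family `u`. With `u`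
orthonormal, suitable values of `a` give isosceles, regular and right simplices. -/
noncomputable def cornerPoints {n m : ℕ} (u : Fin m → E n) (a : ℝ) : Fin (m + 1) → E n :=
  Fin.cons (a • ∑ i, u i) u

section
variable {n m : ℕ} {u : Fin m → E n}

theorem inner_orthonormal_sum (hu : Orthonormal ℝ u) (i : Fin m) :
    (inner ℝ (u i) (∑ j, u j) : ℝ) = 1 := by
  simp [inner_sum, orthonormal_iff_ite.1 hu]

theorem inner_sum_orthonormal (hu : Orthonormal ℝ u) (i : Fin m) :
    (inner ℝ (∑ j, u j) (u i) : ℝ) = 1 := by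
  rw [real_inner_comm, inner_orthonormal_sum hu]

theorem inner_sum_sum (hu : Orthonormal ℝ u) :
    (inner ℝ (∑ j, u j) (∑ j, u j) : ℝ) = m := by
  rw [sum_inner]
  simp only [inner_orthonormal_sum hu, Finset.sum_const, Finset.card_univ, Fintype.card_fin,
    nsmul_eq_mul, mul_one]

theorem norm_orthonormal_sub_smul_sum_sq (hu : Orthonormal ℝ u) (b : ℝ) (i : Fin m) :
    ‖u i - b • ∑ j, u j‖ ^ 2 = 1 - 2 * b + m * b ^ 2 := by
  rw [← real_inner_self_eq_norm_sq, inner_sub_left, inner_sub_right, inner_sub_right]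
  simp only [real_inner_smul_left, real_inner_smul_right, inner_orthonormal_sum hu,
    inner_sum_orthonormal hu, inner_sum_sum hu, orthonormal_iff_ite.1 hu, if_true]
  ring

theorem norm_smul_sum_sq (hu : Orthonormal ℝ u) (b : ℝ) :
    ‖b • ∑ j, u j‖ ^ 2 = m * b ^ 2 := by
  rw [← real_inner_self_eq_norm_sq]
  simp only [real_inner_smul_left, real_inner_smul_right, inner_sum_sum hu]
  ring

theorem affineIndependent_cornerPoints (hu : Orthonormal ℝ u) {a : ℝ} (ha : m * a ≠ 1) :
    AffineIndependent ℝ (cornerPoints u a) := by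
  rw [affineIndependent_iff_of_fintype]
  intro w hw h0
  rw [Finset.univ.weightedVSub_eq_weightedVSubOfPoint_of_sum_eq_zero _ _ hw (0 : E n),
    Finset.weightedVSubOfPoint_apply] at h0
  simp only [vsub_eq_sub, sub_zero, Fin.sum_univ_succ, cornerPoints, Fin.cons_zero,
    Fin.cons_succ] at h0
  -- pair the relation with each `u k`, then add up
  have hk : ∀ k : Fin m, w 0 * a + w k.succ = 0 := fun k => by
    have := congrArg (fun x => inner ℝ (u k) x) h0
    simpa [inner_add_right, real_inner_smul_right, inner_orthonormal_sum hu, inner_sum,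
      orthonormal_iff_ite.1 hu] using this
  have hs : ∑ k : Fin m, w k.succ = -(m * a * w 0) := by
    rw [Finset.sum_congr rfl fun k _ => eq_neg_of_add_eq_zero_right (hk k)]
    simp; ring
  have hw0 : w 0 = 0 := by
    rw [Fin.sum_univ_succ, hs] at hw
    have : (1 - m * a) * w 0 = 0 := by linear_combination hw
    exact (mul_eq_zero.1 this).resolve_left (sub_ne_zero.2 ha.symm)
  refine Fin.cases hw0 fun k => ?_
  have := hk k
  rwa [hw0, zero_mul, zero_add] at this

theorem dist_orthonormal (hu : Orthonormal ℝ u) {i j : Fin m} (hij : i ≠ j) :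
    dist (u i) (u j) = √2 := by
  rw [dist_eq_norm, ← Real.sqrt_sq (norm_nonneg _), norm_sub_sq_real, hu.2 hij, hu.1, hu.1]
  norm_num

theorem dist_corner_apex (hu : Orthonormal ℝ u) (a : ℝ) (i : Fin m) :
    dist (u i) (a • ∑ j, u j) = √(1 - 2 * a + m * a ^ 2) := by
  rw [dist_eq_norm, ← norm_orthonormal_sub_smul_sum_sq hu, Real.sqrt_sq (norm_nonneg _)]

theorem IS_range_cornerPoints (hu : Orthonormal ℝ u) {a : ℝ} (ha : m * a ≠ 1) :
    IS n m (Set.range (cornerPoints u a)) := by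
  refine ⟨⟨_, affineIndependent_cornerPoints hu ha⟩,
    ⟨0, √(1 - 2 * a + m * a ^ 2), Fin.cases (fun h => absurd rfl h) fun j _ => ?_⟩, le_rfl⟩
  rw [dist_comm]
  exact dist_corner_apex hu a j

theorem ES_range_cornerPoints (hu : Orthonormal ℝ u) {a : ℝ} (ha : m * a ≠ 1)
    (ha' : m * a ^ 2 - 2 * a = 1) :
    ES n m (Set.range (cornerPoints u a)) := by
  have h2 : 1 - 2 * a + m * a ^ 2 = 2 := by linarith
  have h0 : ∀ i, dist (u i) (a • ∑ j, u j) = √2 := fun i => by rw [dist_corner_apex hu, h2]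
  refine ⟨⟨_, affineIndependent_cornerPoints hu ha⟩, ⟨√2, fun i j => ?_⟩, le_rfl⟩
  refine Fin.cases (Fin.cases (fun h => absurd rfl h) fun j _ => ?_) (fun i =>
    Fin.cases (fun _ => h0 i) fun j hij => ?_) i j
  · exact (dist_comm _ _).trans (h0 j)
  · exact dist_orthonormal hu fun h => hij (congrArg _ h)

theorem RS_range_cornerPoints (hu : Orthonormal ℝ u) :
    RS n m (Set.range (cornerPoints u 0)) := by
  refine ⟨⟨_, affineIndependent_cornerPoints hu (by simp)⟩, ⟨0, fun j k => ?_⟩, le_rfl⟩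
  refine Fin.cases (fun h => absurd rfl h) (fun j =>
    Fin.cases (fun _ h => absurd rfl h) (fun k _ _ hjk => ?_) k) j
  simpa [cornerPoints] using hu.2 fun h => hjk (congrArg Fin.succ h)

/-- The condition on `a` and `b` says that `b • ∑ j, u j` is equidistant from the apex and from the
points `u i`. -/
theorem norm_cornerPoints_sub (hu : Orthonormal ℝ u) {a b : ℝ}
    (hab : m * (a - b) ^ 2 = 1 - 2 * b + m * b ^ 2) (i : Fin (m + 1)) :
    ‖cornerPoints u a i - b • ∑ j, u j‖ = √(1 - 2 * b + m * b ^ 2) := by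
  rw [← Real.sqrt_sq (norm_nonneg _)]
  congr 1
  refine Fin.cases ?_ (fun i => norm_orthonormal_sub_smul_sum_sq hu b i) i
  simp only [cornerPoints, Fin.cons_zero]
  rw [← sub_smul, norm_smul_sum_sq hu, hab]

theorem one_sub_add_pos (hm : 2 ≤ m) (b : ℝ) : 0 < 1 - 2 * b + m * b ^ 2 := by
  have : (2 : ℝ) ≤ m := by exact_mod_cast hm
  nlinarith [sq_nonneg (b - 1), sq_nonneg b, sq_nonneg (2 * b - 1)]

theorem SimilarityInvariant.range_sub {P : Set (E n) → Prop} (hP : SimilarityInvariant P)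
    {ι : Type*} {v : ι → E n} (hv : P (Set.range v)) (q : E n) : P (Set.range fun i => v i - q) := by
  refine hP.mono ?_ (hP.image (-q) (LinearIsometryEquiv.refl ℝ (E n)) one_ne_zero hv)
  rintro _ ⟨_, ⟨i, rfl⟩, rfl⟩
  exact ⟨i, by simp [sub_eq_neg_add]⟩

/-- For each of the three properties there is an apex parameter `a` for which `cornerPoints` has the
property, with circumcentre `b • ∑ j, u j`. -/
theorem exists_apex_center (hm : 2 ≤ m) {P : Set (E n) → Prop}
    (hP : P = IS n m ∨ P = ES n m ∨ P = RS n m) :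
    ∃ a b : ℝ, m * (a - b) ^ 2 = 1 - 2 * b + m * b ^ 2 ∧
      ∀ u : Fin m → E n, Orthonormal ℝ u → P (Set.range (cornerPoints u a)) := by
  obtain rfl | rfl | rfl := hP
  · refine ⟨0, 1 / 2, by ring, fun u hu => IS_range_cornerPoints hu (by simp)⟩
  · have hm2 : (2 : ℝ) ≤ m := by exact_mod_cast hm
    have hs : √(m + 1 : ℝ) ^ 2 = m + 1 := Real.sq_sqrt (by positivity)
    have hs1 : 1 < √(m + 1 : ℝ) := Real.lt_sqrt_of_sq_lt (by linarith)
    set s := √(m + 1 : ℝ)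
    have hs' : 0 < s - 1 := by linarith
    have hm' : (m : ℝ) = s ^ 2 - 1 := by linarith
    -- `a` is a root of `m a² - 2 a = 1`, and `b • ∑ j, u j` is then the centroid of the points
    refine ⟨1 / (s - 1), 1 / (s * (s - 1)), ?_,
      fun u hu => ES_range_cornerPoints hu ?_ ?_⟩ <;> rw [hm']
    · field_simp
      ring
    · rw [mul_one_div, ne_eq, div_eq_one_iff_eq hs'.ne']
      intro h
      nlinarith
    · field_simp
      ring
  · refine ⟨0, 1 / 2, by ring, fun u hu => RS_range_cornerPoints hu⟩

theorem orthonormal_castLE (h : m ≤ n) :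
    Orthonormal ℝ fun i : Fin m => EuclideanSpace.basisFun (Fin n) ℝ (Fin.castLE h i) :=
  (EuclideanSpace.basisFun (Fin n) ℝ).orthonormal.comp _ (Fin.castLE_injective h)

theorem exists_inscribed (hm : 2 ≤ m) (hmn : m ≤ n) {P : Set (E n) → Prop}
    (hP : P = IS n m ∨ P = ES n m ∨ P = RS n m) (hinv : SimilarityInvariant P) :
    ∃ (v : Fin (m + 1) → E n) (ρ : ℝ), 0 < ρ ∧ (∀ i, ‖v i‖ = ρ) ∧ P (Set.range v) := by
  obtain ⟨a, b, hab, h⟩ := exists_apex_center hm hP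
  have hu := orthonormal_castLE hmn
  exact ⟨_, _, Real.sqrt_pos.2 (one_sub_add_pos hm b), norm_cornerPoints_sub hu hab,
    hinv.range_sub (h _ hu) _⟩

/-- For `m < n`, the centre is shifted by `-e`, with `e` orthogonal to all the points. -/
theorem exists_hemisphere_of_lt (hm : 2 ≤ m) (hmn : m < n) {P : Set (E n) → Prop}
    (hP : P = IS n m ∨ P = ES n m ∨ P = RS n m) (hinv : SimilarityInvariant P) :
    ∃ (v : Fin (m + 1) → E n) (ρ : ℝ) (e : E n), 0 < ρ ∧ (∀ i, ‖v i‖ = ρ) ∧ P (Set.range v) ∧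
      ‖e‖ = 1 ∧ ∀ i, 0 < (inner ℝ e (v i) : ℝ) := by
  obtain ⟨a, b, hab, h⟩ := exists_apex_center hm hP
  have hu := orthonormal_castLE hmn.le
  set u := fun i : Fin m => EuclideanSpace.basisFun (Fin n) ℝ (Fin.castLE hmn.le i) with hudef
  set e := EuclideanSpace.basisFun (Fin n) ℝ ⟨m, hmn⟩
  have he : ‖e‖ = 1 := (EuclideanSpace.basisFun (Fin n) ℝ).orthonormal.1 _
  have heu : ∀ i, (inner ℝ e (u i) : ℝ) = 0 := fun i =>
    (EuclideanSpace.basisFun (Fin n) ℝ).orthonormal.2 fun h => i.2.ne' (congrArg Fin.val h)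
  have hes : (inner ℝ e (∑ j, u j) : ℝ) = 0 := by
    rw [inner_sum]; exact Finset.sum_eq_zero fun i _ => heu i
  have hec : ∀ i, (inner ℝ e (cornerPoints u a i - b • ∑ j, u j) : ℝ) = 0 := fun i => by
    rw [inner_sub_right, real_inner_smul_right, hes, mul_zero, sub_zero]
    refine Fin.cases ?_ (fun i => heu i) i
    simp only [cornerPoints, Fin.cons_zero]
    rw [real_inner_smul_right, hes, mul_zero]
  have hpos := one_sub_add_pos hm b
  refine ⟨fun i => cornerPoints u a i - (b • ∑ j, u j - e), √(1 - 2 * b + m * b ^ 2 + 1), e,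
    by positivity, fun i => ?_, hinv.range_sub (h _ hu) _, he, fun i => ?_⟩
  · rw [← Real.sqrt_sq (norm_nonneg _)]
    dsimp only
    rw [← sub_add, norm_add_sq_real, real_inner_comm, hec,
      norm_cornerPoints_sub hu hab, Real.sq_sqrt hpos.le, he]
    norm_num
  · dsimp only
    rw [← sub_add, inner_add_right, hec, real_inner_self_eq_norm_sq, he]
    norm_num

/-- The apex is the pole `(∑ j, u j) / √n` of the hemisphere, and the other points are the standard
basis vectors. -/
theorem exists_hemisphere_IS (hn : 2 ≤ n) :
    ∃ (v : Fin (n + 1) → E n) (ρ : ℝ) (e : E n), 0 < ρ ∧ (∀ i, ‖v i‖ = ρ) ∧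
      IS n n (Set.range v) ∧ ‖e‖ = 1 ∧ ∀ i, 0 < (inner ℝ e (v i) : ℝ) := by
  have hn2 : (2 : ℝ) ≤ n := by exact_mod_cast hn
  have hu := (EuclideanSpace.basisFun (Fin n) ℝ).orthonormal
  set u := EuclideanSpace.basisFun (Fin n) ℝ
  have hs : √(n : ℝ) ^ 2 = n := Real.sq_sqrt (by positivity)
  have hs0 : 0 < √(n : ℝ) := by positivity
  have hs1 : √(n : ℝ) ≠ 1 := fun h => by rw [h] at hs; linarith
  have hn' : (n : ℝ) * (√(n : ℝ))⁻¹ ^ 2 = 1 := by rw [inv_pow, hs]; field_simp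
  refine ⟨cornerPoints u (√n)⁻¹, 1, (√n)⁻¹ • ∑ j, u j, one_pos, fun i => ?_,
    IS_range_cornerPoints hu ?_, ?_, fun i => ?_⟩
  · have := norm_cornerPoints_sub hu (a := (√(n : ℝ))⁻¹) (b := 0) (by rw [sub_zero, hn']; ring) i
    simpa using this
  · rw [← div_eq_mul_inv, Real.div_sqrt]
    exact hs1
  · rw [← Real.sqrt_sq (norm_nonneg _), norm_smul_sum_sq hu, hn', Real.sqrt_one]
  · rw [real_inner_smul_left]
    refine mul_pos (by positivity) (Fin.cases ?_ (fun i => ?_) i)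
    · simp only [cornerPoints, Fin.cons_zero]
      rw [real_inner_smul_right, inner_sum_sum hu]
      positivity
    · simp only [cornerPoints, Fin.cons_succ]
      rw [inner_sum_orthonormal hu]
      exact one_pos

/-- The points `0, e₁, …, eₙ` have circumcentre `(∑ j, e j) / 2`. Its coordinate sum `n / 2`
exceeds `1` when `n ≥ 3`, while the points have coordinate sum at most `1`: seen from the
circumcentre, all of them lie on the side of `-∑ j, e j`. -/
theorem exists_hemisphere_RS (hn : 3 ≤ n) :
    ∃ (v : Fin (n + 1) → E n) (ρ : ℝ) (e : E n), 0 < ρ ∧ (∀ i, ‖v i‖ = ρ) ∧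
      RS n n (Set.range v) ∧ ‖e‖ = 1 ∧ ∀ i, 0 < (inner ℝ e (v i) : ℝ) := by
  have hn3 : (3 : ℝ) ≤ n := by exact_mod_cast hn
  have hu := (EuclideanSpace.basisFun (Fin n) ℝ).orthonormal
  set u := EuclideanSpace.basisFun (Fin n) ℝ
  have hs : √(n : ℝ) ^ 2 = n := Real.sq_sqrt (by positivity)
  have hs0 : 0 < √(n : ℝ) := by positivity
  have hn' : (n : ℝ) * (-(√(n : ℝ))⁻¹) ^ 2 = 1 := by rw [neg_sq, inv_pow, hs]; field_simp
  refine ⟨fun i => cornerPoints u 0 i - (1 / 2 : ℝ) • ∑ j, u j, _, (-(√(n : ℝ))⁻¹) • ∑ j, u j,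
    Real.sqrt_pos.2 (one_sub_add_pos (by omega) (1 / 2)), norm_cornerPoints_sub hu (by ring),
    (similarityInvariant_RS n n).range_sub (RS_range_cornerPoints hu) _, ?_, fun i => ?_⟩
  · rw [← Real.sqrt_sq (norm_nonneg _), norm_smul_sum_sq hu, hn', Real.sqrt_one]
  · rw [real_inner_smul_left, neg_mul, ← mul_neg, inner_sub_right, real_inner_smul_right,
      inner_sum_sum hu]
    refine mul_pos (by positivity) (Fin.cases ?_ (fun i => ?_) i)
    · simp only [cornerPoints, Fin.cons_zero, zero_smul, inner_zero_right]
      linarith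
    · simp only [cornerPoints, Fin.cons_succ]
      rw [inner_sum_orthonormal hu]
      linarith
end

/-! ### Colorings with convex classes -/

/-- If the centre of a sphere lies in the convex hull of every set with property `P` on the sphere,
then colourings with convex classes satisfy the forcing condition. -/
theorem satisfiesQ_of_convex {n : ℕ} {C : Type*} {P : Set (E n) → Prop} {R : Set ℝ}
    {f : E n → C} (hP : ∀ p r A, A ⊆ Metric.sphere p r → P A → p ∈ convexHull ℝ A)
    (hf : ∀ c, Convex ℝ (f ⁻¹' {c})) : SatisfiesQ P Set.univ R f := by
  rintro c p - r - ⟨T, hT, hPT⟩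
  exact convexHull_min (hT.trans Set.inter_subset_left) (hf c)
    (hP p r T (hT.trans Set.inter_subset_right) hPT)

theorem affineSpan_range_simplex {n : ℕ} (s : Affine.Simplex ℝ (E n) n) :
    affineSpan ℝ (Set.range s.points) = ⊤ :=
  s.independent.affineSpan_eq_top_iff_card_eq_finrank_add_one.2 (by simp)

/-- The centre `p` of a sphere circumscribed about a regular `n`-simplex in `ℝⁿ` is its centroid:
pairing `∑ j, w j • (s.points j - p) = 0` with each `s.points i - p` shows that the barycentric
coordinates `w` of `p` are all equal. -/
theorem mem_convexHull_of_ES {n : ℕ} (hn : 1 ≤ n) (p : E n) (r : ℝ) (A : Set (E n))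
    (hA : A ⊆ Metric.sphere p r) (h : ES n n A) : p ∈ convexHull ℝ A := by
  obtain ⟨s, ⟨d, hd⟩, hs⟩ := h
  have hr : ∀ i, ‖s.points i - p‖ = r := fun i => by
    rw [← dist_eq_norm]; exact hA (hs ⟨i, rfl⟩)
  have hd0 : d ^ 2 ≠ 0 := by
    have h01 : (0 : Fin (n + 1)) ≠ Fin.last n := by
      rw [ne_eq, Fin.ext_iff]; simp; omega
    rw [← hd _ _ h01]
    exact pow_ne_zero 2 (dist_ne_zero.2 (s.independent.injective.ne h01))
  obtain ⟨w, hw, hpw⟩ := eq_affineCombination_of_mem_affineSpan_of_fintype (k := ℝ)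
    (p := s.points) (p1 := p) (by rw [affineSpan_range_simplex]; trivial)
  rw [Finset.affineCombination_eq_linear_combination _ _ _ hw] at hpw
  have hsum : ∑ j, w j • (s.points j - p) = 0 := by
    simp only [smul_sub, Finset.sum_sub_distrib, ← Finset.sum_smul, hw, ← hpw, one_smul, sub_self]
  have hin : ∀ i j, (inner ℝ (s.points i - p) (s.points j - p) : ℝ) =
      r ^ 2 - d ^ 2 / 2 + if i = j then d ^ 2 / 2 else 0 := fun i j => by
    split_ifs with hij
    · rw [hij, real_inner_self_eq_norm_sq, hr]; ring
    · have := norm_sub_sq_real (s.points i - p) (s.points j - p)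
      rw [sub_sub_sub_cancel_right, ← dist_eq_norm, hd i j hij, hr, hr] at this
      linarith
  have hwi : ∀ i, w i * (d ^ 2 / 2) = d ^ 2 / 2 - r ^ 2 := fun i => by
    have := congrArg (fun x => (inner ℝ (s.points i - p) x : ℝ)) hsum
    simp only [inner_sum, real_inner_smul_right, hin, inner_zero_right, mul_add,
      Finset.sum_add_distrib, ← Finset.sum_mul, hw, mul_ite, mul_zero, Finset.sum_ite_eq,
      Finset.mem_univ, if_true] at this
    linarith
  have hconst : ∀ i j, w i = w j := fun i j =>
    mul_right_cancel₀ (div_ne_zero hd0 two_ne_zero) ((hwi i).trans (hwi j).symm)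
  have hnonneg : ∀ i, 0 ≤ w i := fun i => by
    have h1 : ((n : ℝ) + 1) * w i = 1 := by
      have h2 := hw
      rw [Finset.sum_congr rfl fun j _ => hconst j i] at h2
      simpa using h2
    by_contra! hneg
    have : ((n : ℝ) + 1) * w i < 0 := mul_neg_of_pos_of_neg (by positivity) hneg
    linarith
  rw [hpw]
  exact (convex_convexHull ℝ A).sum_mem (fun i _ => hnonneg i) hw
    fun i _ => subset_convexHull ℝ A (hs ⟨i, rfl⟩)

/-- Thales: the circumcentre of a right triangle is the midpoint of the hypotenuse. -/
theorem mem_convexHull_of_RS (p : E 2) (r : ℝ) (A : Set (E 2))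
    (hA : A ⊆ Metric.sphere p r) (h : RS 2 2 A) : p ∈ convexHull ℝ A := by
  obtain ⟨s, ⟨i, hi⟩, hs⟩ := h
  obtain ⟨j, k, hj, hk, hjk, hall⟩ : ∃ j k : Fin 3, j ≠ i ∧ k ≠ i ∧ j ≠ k ∧
      ∀ l, l = i ∨ l = j ∨ l = k := by
    clear hi
    revert i
    decide
  have hmid : ∀ l, dist (s.points l) (midpoint ℝ (s.points j) (s.points k)) =
      dist (s.points j) (midpoint ℝ (s.points j) (s.points k)) := fun l => by
    obtain rfl | rfl | rfl := hall l
    · have hsq := (norm_sub_eq_norm_add (hi k j hk hj hjk.symm)).symm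
      have e1 : s.points l - midpoint ℝ (s.points j) (s.points k) =
          (-(1 / 2 : ℝ)) • ((s.points j - s.points l) + (s.points k - s.points l)) := by
        rw [midpoint_eq_smul_add, invOf_eq_inv]; module
      have e2 : s.points j - midpoint ℝ (s.points j) (s.points k) =
          (1 / 2 : ℝ) • ((s.points j - s.points l) - (s.points k - s.points l)) := by
        rw [midpoint_eq_smul_add, invOf_eq_inv]; module
      rw [dist_eq_norm, dist_eq_norm, e1, e2, norm_smul, norm_smul, hsq, norm_neg]
    · rfl
    · rw [dist_left_midpoint_eq_dist_right_midpoint, dist_comm]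
  have hp : p = midpoint ℝ (s.points j) (s.points k) :=
    (s.eq_circumcenter_of_dist_eq (by rw [affineSpan_range_simplex]; trivial)
      fun l => hA (hs ⟨l, rfl⟩)).trans
    (s.eq_circumcenter_of_dist_eq (by rw [affineSpan_range_simplex]; trivial) hmid).symm
  rw [hp]
  exact (convex_convexHull ℝ A).midpoint_mem (subset_convexHull ℝ A (hs ⟨j, rfl⟩))
    (subset_convexHull ℝ A (hs ⟨k, rfl⟩))

theorem somewhereComeager_of_isOpen {X : Type*} [TopologicalSpace X] {U A : Set X} (hU : IsOpen U)
    (hne : U.Nonempty) (h : U ⊆ A) : SomewhereComeager A :=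
  ⟨U, hU, hne, Filter.mem_of_superset Filter.univ_mem fun x _ => h x.2⟩

theorem satisfiesQStar_strips {n : ℕ} (hn : 0 < n) {P : Set (E n) → Prop} {R : Set ℝ} {ε : ℝ}
    (hP : ∀ p r A, A ⊆ Metric.sphere p r → P A → p ∈ convexHull ℝ A)
    (hR : RadiiComeagerNearZero R ε) : SatisfiesQStar P R ε (strips n hn) := by
  set i : Fin n := ⟨n - 1, Nat.sub_lt hn Nat.one_pos⟩
  refine ⟨hR, ⟨0, somewhereComeager_of_isOpen (U := {x : E n | 0 < x i} ∩ {x | x i < 1})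
    ((isOpen_lt (by fun_prop) (by fun_prop)).inter (isOpen_lt (by fun_prop) (by fun_prop)))
    ⟨EuclideanSpace.single i (1 / 2), by simp, by simp; norm_num⟩ fun x hx => ?_⟩,
    satisfiesQ_of_convex hP fun c => ?_⟩
  · exact Int.floor_eq_zero_iff.2 ⟨hx.1.le, hx.2⟩
  · have : strips n hn ⁻¹' {c} = EuclideanSpace.proj (𝕜 := ℝ) i ⁻¹' Set.Ico (c : ℝ) (c + 1) := by
      ext x; exact Int.floor_eq_iff
    rw [this]
    exact (convex_Ico _ _).linear_preimage (EuclideanSpace.proj (𝕜 := ℝ) i).toLinearMap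

theorem not_monochromatic_strips {n : ℕ} (hn : 0 < n) : ¬ Monochromatic (strips n hn) := fun h => by
  have := h 0 (EuclideanSpace.single ⟨n - 1, Nat.sub_lt hn Nat.one_pos⟩ 1)
  simp [strips] at this

open Classical in
/-- Two colours suffice: colour two complementary half-spaces differently. -/
theorem exists_halfspace_coloring {n : ℕ} (hn : 0 < n) {C : Type*} [Nontrivial C]
    {P : Set (E n) → Prop} {R : Set ℝ} {ε : ℝ}
    (hP : ∀ p r A, A ⊆ Metric.sphere p r → P A → p ∈ convexHull ℝ A)
    (hR : RadiiComeagerNearZero R ε) :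
    ∃ f : E n → C, SatisfiesQStar P R ε f ∧ ¬ Monochromatic f := by
  obtain ⟨a, b, hab⟩ := exists_pair_ne C
  set i : Fin n := ⟨0, hn⟩
  refine ⟨fun x => if x i < 0 then a else b, ⟨hR, ⟨b, somewhereComeager_of_isOpen
    (U := {x : E n | 0 < x i}) (isOpen_lt (by fun_prop) (by fun_prop))
    ⟨EuclideanSpace.single i 1, by simp⟩ fun x hx => if_neg (not_lt_of_gt hx)⟩,
    satisfiesQ_of_convex hP fun c => ?_⟩, fun h => ?_⟩
  · have hconv : ∀ S : Set ℝ, Convex ℝ S → Convex ℝ {x : E n | x i ∈ S} := fun S hS =>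
      hS.linear_preimage (EuclideanSpace.proj (𝕜 := ℝ) i).toLinearMap
    by_cases ha : a = c
    · subst ha
      convert hconv _ (convex_Iio 0) using 1
      ext x
      by_cases hx : x i < 0 <;> simp [hx, hab.symm]
    · by_cases hb : b = c
      · subst hb
        convert hconv _ (convex_Ici 0) using 1
        ext x
        by_cases hx : x i < 0 <;> simp [hx, hab, not_lt.1]
      · convert convex_empty (𝕜 := ℝ) (E := E n) using 1
        ext x
        by_cases hx : x i < 0 <;> simp [hx, ha, hb]
  · have := h (EuclideanSpace.single i (-1)) 0
    simp at this
    exact hab this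

/-! ### The dichotomy -/

theorem theorem4 {C : Type*} (n m : ℕ) (hm : 2 ≤ m) (hmn : m ≤ n) (R : Set ℝ) (ε : ℝ)
    (P : Set (E n) → Prop) (hP : P = IS n m ∨ P = ES n m ∨ P = RS n m) :
    ((m < n ∨ (m = n ∧ P = IS n n) ∨ (m = n ∧ 3 ≤ n ∧ P = RS n n)) →
      ∀ f : E n → C, SatisfiesQStar P R ε f → Monochromatic f) ∧
    (((m = n ∧ P = ES n n) ∨ (m = n ∧ n = 2 ∧ P = RS n n)) →
      (∀ f : E n → C, SatisfiesQStar P R ε f → SomewhereMonochromatic f) ∧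
      (RadiiComeagerNearZero R ε →
        (SatisfiesQStar P R ε (strips n (by omega)) ∧ ¬ Monochromatic (strips n (by omega))) ∧
        (Nontrivial C → ∃ f : E n → C, SatisfiesQStar P R ε f ∧ ¬ Monochromatic f))) := by
  have hinv : SimilarityInvariant P := by
    rcases hP with h | h | h <;> rw [h]
    exacts [similarityInvariant_IS n m, similarityInvariant_ES n m, similarityInvariant_RS n m]
  have hlocal : ∀ f : E n → C, SatisfiesQStar P R ε f →
      ∃ c U, IsOpen U ∧ U.Nonempty ∧ ∀ x ∈ U, f x = c := by
    rintro f ⟨hR, ⟨c, U, hU, hne, hc⟩, hf⟩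
    obtain ⟨v, ρ, hρ, hv, hPv⟩ := exists_inscribed hm hmn hP hinv
    exact ⟨c, U, hU, hne, fun x hx => eq_of_comeagerIn hinv hρ hv hPv hR hf hU hc hx⟩
  refine ⟨fun hcase f hf => ?_, fun hcase => ⟨fun f hf => ?_, fun hR => ?_⟩⟩
  · obtain ⟨c, U, hU, hne, hc⟩ := hlocal f hf
    have hhemi : ∃ (v : Fin (m + 1) → E n) (ρ : ℝ) (e : E n), 0 < ρ ∧ (∀ i, ‖v i‖ = ρ) ∧
        P (Set.range v) ∧ ‖e‖ = 1 ∧ ∀ i, 0 < (inner ℝ e (v i) : ℝ) := by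
      rcases hcase with h | ⟨rfl, h⟩ | ⟨rfl, h3, h⟩
      · exact exists_hemisphere_of_lt hm h hP hinv
      · rw [h]; exact exists_hemisphere_IS hm
      · rw [h]; exact exists_hemisphere_RS h3
    obtain ⟨v, ρ, e, hρ, hv, hPv, he, hev⟩ := hhemi
    have hconst := monochromatic_of_hemisphere hinv hρ hv hPv he hev hf.radii hf.forcing hU hne hc
    exact fun x y => (hconst x).trans (hconst y).symm
  · obtain ⟨c, U, hU, hne, hc⟩ := hlocal f hf
    exact ⟨U, hU, hne, fun x hx y hy => (hc x hx).trans (hc y hy).symm⟩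
  · have hconv : ∀ p r A, A ⊆ Metric.sphere p r → P A → p ∈ convexHull ℝ A := by
      rcases hcase with ⟨-, rfl⟩ | ⟨-, rfl, rfl⟩
      · exact mem_convexHull_of_ES (by omega)
      · exact mem_convexHull_of_RS
    exact ⟨⟨satisfiesQStar_strips _ hconv hR, not_monochromatic_strips _⟩,
      fun _ => exists_halfspace_coloring (by omega) hconv hR⟩
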